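/- Let $K$ be a field. Call a finite-dimensional $K$-algebra $B$ \emph{symmetric} if $B\cong \operatorname{Hom}_K(B,K)$ as $B$-bimodules, and call a finite-dimensional right $B$-module $M$ a \emph{generator} if the regular right module $B$ is a direct summand of $M^n$ for some $n$. A $K$-algebra $A$ is called \emph{gendo-symmetric} if it is isomorphic, as a $K$-algebra, to $\operatorname{End}_B(M)$ for some finite-dimensional symmetric $K$-algebra $B$ and some finite-dimensional right $B$-module $M$ that is a generator; such an $A$ is finite-dimensional. 1. If $A$ and $B$ are gendo-symmetric $K$-algebras, then $A\otimes_K B$ is a gendo-symmetric $K$-algebra. 2. Let $A$ be a gendo-symmetric $K$-algebra and let $F$ be any field extension of $K$. Then $A\otimes_K F$ is a gendo-symmetric $F$-algebra. If moreover $F$ is finite-dimensional over $K$, then $A\otimes_K F$ is also gendo-symmetric as a $K$-algebra. -/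

import Mathlib

universe u v w x

open scoped TensorProduct

/-- A symmetric algebra over the field `K`: a finite dimensional algebra `B` which is isomorphic,
as a `B`-bimodule, to its dual `D(B) = Hom_K(B, K)`. The bimodule structure of `D(B)` is
`(a • f • b) y = f (b * y * a)`, so that the displayed equation says `φ (a x b) = a • φ x • b`. -/
def IsSymmetricAlg (K : Type*) [Field K] (B : Type*) [Ring B] [Algebra K B] : Prop :=
  Module.Finite K B ∧
    ∃ φ : B ≃ₗ[K] Module.Dual K B, ∀ a x b y : B, φ (a * x * b) y = φ x (b * y * a)

/-- The right `B`-module `M` is a generator: the regular right module `B` is a direct summand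
of a finite direct sum of copies of `M`. Right `B`-modules are modules over `Bᵐᵒᵖ`. -/
def IsGeneratorRightModule (B : Type*) [Ring B] (M : Type*) [AddCommGroup M] [Module Bᵐᵒᵖ M] :
    Prop :=
  ∃ (n : ℕ) (i : B →ₗ[Bᵐᵒᵖ] (Fin n → M)) (p : (Fin n → M) →ₗ[Bᵐᵒᵖ] B), p ∘ₗ i = LinearMap.id

/-- A `K`-algebra `A` is gendo-symmetric if it is isomorphic, as a `K`-algebra, to the algebra
`End_B(M)` of endomorphisms of a finite dimensional right module `M` that is a generator over a
symmetric `K`-algebra `B`. Such an `A` is finite dimensional.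

Taking `B` and `M` in the universe of `A` is no restriction: if `A` is nonzero then `K` embeds
in `A`, so every finite dimensional `K`-vector space has a copy in that universe; if `A` is zero
then so are `M` and `B`. -/
def IsGendoSymmetric (K : Type*) [Field K] (A : Type u) [Ring A] [Algebra K A] : Prop :=
  ∃ (B : Type u) (_ : Ring B) (_ : Algebra K B) (M : Type u) (_ : AddCommGroup M)
    (_ : Module K M) (_ : Module Bᵐᵒᵖ M) (_ : IsScalarTower K Bᵐᵒᵖ M),
    IsSymmetricAlg K B ∧ Module.Finite K M ∧ IsGeneratorRightModule B M ∧
      Nonempty (A ≃ₐ[K] Module.End Bᵐᵒᵖ M)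

/-!
Inside `End_F(M ⊗ N) = End_F(M) ⊗ End_K(N)`, the algebra `End_{B ⊗ D}(M ⊗ N)` is the centralizer of
the image of `B ⊗ D`, and over a field this centralizer is the tensor product of the centralizers
of `B` and of `D`, that is `End_B(M) ⊗ End_D(N)`. Symmetry of `B ⊗ D` is witnessed by the tensor
product of two symmetrizing forms, and `M ⊗ N` is a generator because the trace identities
`∑ p j (m j) = 1` multiply. All this works with `B` and `M` over an extension field `F` of the
base field `K` of `D` and `N`. A field which is finite over `K` is a symmetric `K`-algebra, by any
nonzero linear form, hence gendo-symmetric; so tensoring with `F`, seen as an algebra over `F` or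
over `K`, is a special case.
-/

open MulOpposite Algebra.TensorProduct

section Centralizer

theorem preimage_centralizer_image {G H Φ : Type*} [Mul G] [Mul H] [FunLike Φ G H]
    [MulHomClass Φ G H] {f : Φ} (hf : Function.Injective f) (s : Set G) :
    f ⁻¹' (f '' s).centralizer = s.centralizer := by
  ext x
  simp only [Set.mem_preimage, Set.mem_centralizer_iff, Set.forall_mem_image, ← map_mul, hf.eq_iff]

theorem image_centralizer {G H Φ : Type*} [Mul G] [Mul H] [FunLike Φ G H]
    [MulHomClass Φ G H] {f : Φ} (hf : Function.Bijective f) (s : Set G) :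
    f '' s.centralizer = (f '' s).centralizer := by
  rw [← preimage_centralizer_image hf.injective, Set.image_preimage_eq _ hf.surjective]

variable {K A A' C C' P Q : Type*} [Field K] [Ring A] [Algebra K A] [Ring A'] [Algebra K A']
  [Ring C] [Algebra K C] [Ring C'] [Algebra K C'] [Ring P] [Algebra K P] [Ring Q] [Algebra K Q]

theorem centralizer_includeLeft_inf_centralizer_includeRight (S : Set P) (T : Set Q) :
    Subalgebra.centralizer K ((includeLeft : P →ₐ[K] P ⊗[K] Q) '' S) ⊓
        Subalgebra.centralizer K ((includeRight : Q →ₐ[K] P ⊗[K] Q) '' T) =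
      (map (Subalgebra.centralizer K S).val (Subalgebra.centralizer K T).val).range := by
  let ι : Subalgebra.centralizer K S ⊗[K] Q →ₐ[K] P ⊗[K] Q :=
    map (Subalgebra.centralizer K S).val (AlgHom.id K Q)
  have hι : Function.Injective ι :=
    Module.Flat.rTensor_preserves_injective_linearMap (M := Q)
      (Subalgebra.centralizer K S).val.toLinearMap Subtype.val_injective
  have hT : (includeRight : Q →ₐ[K] P ⊗[K] Q) '' T =
      ι '' ((includeRight : Q →ₐ[K] Subalgebra.centralizer K S ⊗[K] Q) '' T) := by
    rw [← Set.image_comp, ← AlgHom.coe_comp, map_comp_includeRight, AlgHom.comp_id]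
  have hcomap : (Subalgebra.centralizer K ((includeRight : Q →ₐ[K] P ⊗[K] Q) '' T)).comap ι =
      (map (AlgHom.id K (Subalgebra.centralizer K S)) (Subalgebra.centralizer K T).val).range := by
    rw [← Subalgebra.centralizer_coe_image_includeRight_eq_center_tensorProduct, hT]
    exact SetLike.coe_injective (preimage_centralizer_image hι _)
  rw [Subalgebra.centralizer_coe_image_includeLeft_eq_center_tensorProduct, inf_comm,
    ← Subalgebra.map_comap_eq, hcomap, ← AlgHom.range_comp, ← map_comp, AlgHom.comp_id,
    AlgHom.id_comp]

theorem range_map_eq_centralizer {f : A →ₐ[K] P} {f' : A' →ₐ[K] P} {g : C →ₐ[K] Q}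
    {g' : C' →ₐ[K] Q} (hf : Set.range f' = (Set.range f).centralizer)
    (hg : Set.range g' = (Set.range g).centralizer) :
    Set.range (map f' g') = (Set.range (map f g)).centralizer := by
  have hf : f'.range = Subalgebra.centralizer K (Set.range f) := SetLike.coe_injective hf
  have hg : g'.range = Subalgebra.centralizer K (Set.range g) := SetLike.coe_injective hg
  suffices (map f' g').range = Subalgebra.centralizer K ((map f g).range : Set (P ⊗[K] Q)) from
    congrArg SetLike.coe this
  rw [map_range f g, Subalgebra.centralizer_coe_sup, AlgHom.range_comp, AlgHom.range_comp,
    Subalgebra.coe_map, Subalgebra.coe_map, AlgHom.coe_range, AlgHom.coe_range,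
    centralizer_includeLeft_inf_centralizer_includeRight, map_range, map_range]
  simp only [AlgHom.range_comp, hf, hg, Subalgebra.range_val]

end Centralizer

section Endomorphisms

variable (K F R M : Type*) [CommSemiring K] [CommSemiring F] [Algebra K F] [Semiring R]
  [Algebra K R] [Algebra F R] [AddCommMonoid M] [Module K M] [Module F M]
  [IsScalarTower K F M] [Module R M] [IsScalarTower K R M] [IsScalarTower F R M]

theorem lsmul_end_injective :
    Function.Injective (Algebra.lsmul K F M : Module.End R M →ₐ[K] Module.End F M) :=
  fun _ _ h => LinearMap.ext fun x => LinearMap.congr_fun h x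

theorem range_lsmul_end :
    Set.range (Algebra.lsmul K F M : Module.End R M →ₐ[K] Module.End F M) =
      (Set.range (Algebra.lsmul K F M : R →ₐ[K] Module.End F M)).centralizer := by
  ext f
  rw [Set.mem_centralizer_iff, Set.forall_mem_range]
  constructor
  · rintro ⟨g, rfl⟩ r
    exact LinearMap.ext fun x => (g.map_smul r x).symm
  · intro hf
    exact ⟨{ f with map_smul' := fun r x => (LinearMap.congr_fun (hf r) x).symm }, rfl⟩

end Endomorphisms

section HomTensor

variable (K F M N P Q : Type*) [CommRing K] [CommRing F] [Algebra K F]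
  [AddCommGroup M] [Module K M] [Module F M] [IsScalarTower K F M] [AddCommGroup N] [Module K N]

theorem finite_tensorProduct [Module.Finite F M] [Module.Finite K N] :
    Module.Finite F (M ⊗[K] N) :=
  .equiv (TensorProduct.AlgebraTensorModule.cancelBaseChange K F F M N)

variable [AddCommGroup P] [Module K P] [Module F P] [IsScalarTower K F P] [AddCommGroup Q]
  [Module K Q] [Module.Finite F M] [Module.Free F M] [Module.Finite F P] [Module.Free F P]
  [Module.Finite K N] [Module.Free K N] [Module.Finite K Q] [Module.Free K Q]

theorem homTensorHomMap_bijective :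
    Function.Bijective (TensorProduct.AlgebraTensorModule.homTensorHomMap K F F M N P Q) := by
  classical
  let bM := Module.Free.chooseBasis F M
  let bN := Module.Free.chooseBasis K N
  let bP := Module.Free.chooseBasis F P
  let bQ := Module.Free.chooseBasis K Q
  let bHom := (bM.linearMap bP).tensorProduct (bN.linearMap bQ)
  let e := bHom.equiv ((bM.tensorProduct bN).linearMap (bP.tensorProduct bQ))
    (Equiv.prodProdProdComm _ _ _ _)
  suffices TensorProduct.AlgebraTensorModule.homTensorHomMap K F F M N P Q = e.toLinearMap from
    this ▸ e.bijective
  refine bHom.ext fun ⟨⟨i, j⟩, k, l⟩ => (bM.tensorProduct bN).ext fun ⟨j', l'⟩ => ?_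
  rw [LinearEquiv.coe_coe, Module.Basis.equiv_apply, Module.Basis.linearMap_apply_apply]
  simp only [bHom, Equiv.prodProdProdComm_apply, Module.Basis.linearMap_apply_apply,
    Module.Basis.tensorProduct_apply, TensorProduct.AlgebraTensorModule.homTensorHomMap_apply,
    TensorProduct.AlgebraTensorModule.map_tmul, Prod.mk.injEq]
  split_ifs <;> simp_all

theorem dualDistrib_injective :
    Function.Injective (TensorProduct.AlgebraTensorModule.dualDistrib K F M N) :=
  (Algebra.TensorProduct.rid K F F).toLinearEquiv.congrRight.injective.comp
    (homTensorHomMap_bijective K F M N F K).injective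

end HomTensor

section SymmetrizingForm

/-- A symmetrizing form on a `K`-algebra `B`: a linear form `t` such that `(x, y) ↦ t (x * y)` is
a symmetric bilinear form without kernel. The finite dimensional algebras having such a form are
the symmetric algebras. -/
structure IsSymmetrizingForm {K B : Type*} [CommSemiring K] [Semiring B] [Algebra K B]
    (t : Module.Dual K B) : Prop where
  map_mul_comm : ∀ x y, t (x * y) = t (y * x)
  injective : Function.Injective ((LinearMap.mul K B).compr₂ t)

variable {K F B D : Type*} [Field K] [Field F] [Algebra K F]
  [Ring B] [Algebra K B] [Algebra F B] [IsScalarTower K F B] [Ring D] [Algebra K D]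

theorem IsSymmetricAlg.exists_isSymmetrizingForm (hD : IsSymmetricAlg K D) :
    ∃ t : Module.Dual K D, IsSymmetrizingForm t := by
  obtain ⟨-, φ, hφ⟩ := hD
  have apply_eq (x y : D) : φ x y = φ 1 (x * y) := by simpa using hφ 1 1 x y
  have apply_eq' (x y : D) : φ x y = φ 1 (y * x) := by simpa using hφ x 1 1 y
  refine ⟨φ 1, fun x y => (apply_eq x y).symm.trans (apply_eq' x y), ?_⟩
  rw [show (LinearMap.mul K D).compr₂ (φ 1) = φ from
    LinearMap.ext₂ fun x y => (apply_eq x y).symm]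
  exact φ.injective

theorem IsSymmetrizingForm.isSymmetricAlg [Module.Finite K D] {t : Module.Dual K D}
    (ht : IsSymmetrizingForm t) : IsSymmetricAlg K D := by
  refine ⟨inferInstance, LinearEquiv.ofInjectiveOfFinrankEq _ ht.injective
    Subspace.dual_finrank_eq.symm, fun a x b y => ?_⟩
  calc t (a * x * b * y) = t (a * (x * (b * y))) := by simp only [mul_assoc]
    _ = t (x * (b * y) * a) := ht.map_mul_comm _ _
    _ = t (x * (b * y * a)) := by simp only [mul_assoc]

theorem IsSymmetrizingForm.tensorProduct [Module.Finite F B] [Module.Finite K D]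
    {t : Module.Dual F B} {s : Module.Dual K D} (ht : IsSymmetrizingForm t)
    (hs : IsSymmetrizingForm s) :
    IsSymmetrizingForm (TensorProduct.AlgebraTensorModule.dualDistrib K F B D (t ⊗ₜ s)) where
  map_mul_comm x y := by
    induction x with
    | zero => simp only [zero_mul, mul_zero]
    | add x₁ x₂ h₁ h₂ => simp only [add_mul, mul_add, map_add, h₁, h₂]
    | tmul b d =>
      induction y with
      | zero => simp only [zero_mul, mul_zero]
      | add y₁ y₂ h₁ h₂ => simp only [add_mul, mul_add, map_add, h₁, h₂]
      | tmul b' d' =>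
        simp only [tmul_mul_tmul, TensorProduct.AlgebraTensorModule.dualDistrib_apply,
          ht.map_mul_comm b b', hs.map_mul_comm d d']
  injective := by
    let τ := (LinearMap.mul F B).compr₂ t
    let σ := (LinearMap.mul K D).compr₂ s
    have hfactor : (LinearMap.mul F (B ⊗[K] D)).compr₂
          (TensorProduct.AlgebraTensorModule.dualDistrib K F B D (t ⊗ₜ s)) =
        TensorProduct.AlgebraTensorModule.dualDistrib K F B D ∘ₗ
          TensorProduct.AlgebraTensorModule.map τ σ := by
      ext b d b' d'
      simp [τ, σ]
    rw [hfactor]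
    exact (dualDistrib_injective K F B D).comp
      (TensorProduct.map_injective_of_flat_flat (τ.restrictScalars K) σ ht.injective hs.injective)

theorem IsSymmetrizingForm.of_ne_zero {t : Module.Dual K F} (ht : t ≠ 0) :
    IsSymmetrizingForm t where
  map_mul_comm x y := by rw [mul_comm]
  injective := by
    rw [injective_iff_map_eq_zero]
    intro x hx
    by_contra hx₀
    refine ht (LinearMap.ext fun y => ?_)
    simpa [mul_inv_cancel_left₀ hx₀] using LinearMap.congr_fun hx (x⁻¹ * y)

theorem IsSymmetricAlg.tensorProduct (hB : IsSymmetricAlg F B) (hD : IsSymmetricAlg K D) :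
    IsSymmetricAlg F (B ⊗[K] D) := by
  obtain ⟨t, ht⟩ := hB.exists_isSymmetrizingForm
  obtain ⟨s, hs⟩ := hD.exists_isSymmetrizingForm
  have := hB.1
  have := hD.1
  have := finite_tensorProduct K F B D
  exact (ht.tensorProduct hs).isSymmetricAlg

variable (K F) in
theorem isSymmetricAlg_field [Module.Finite K F] : IsSymmetricAlg K F := by
  obtain ⟨t, ht⟩ := exists_ne (0 : Module.Dual K F)
  exact (IsSymmetrizingForm.of_ne_zero ht).isSymmetricAlg

end SymmetrizingForm

section RightModule

variable {K B D M N : Type*} [CommSemiring K] [Semiring B] [Algebra K B] [Semiring D] [Algebra K D]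
  [AddCommMonoid M] [Module K M] [Module Bᵐᵒᵖ M] [IsScalarTower K Bᵐᵒᵖ M]
  [AddCommMonoid N] [Module K N] [Module Dᵐᵒᵖ N] [IsScalarTower K Dᵐᵒᵖ N]

/-- The right `B ⊗ D`-module structure on `M ⊗ N` given by `(x ⊗ y) (b ⊗ d) = x b ⊗ y d`. The low
priority keeps the regular module structure the default one on `B ⊗ D`. -/
noncomputable instance (priority := low) tensorRightModule :
    Module (B ⊗[K] D)ᵐᵒᵖ (M ⊗[K] N) :=
  Module.compHom (M ⊗[K] N)
    (Module.endTensorEndAlgHom.comp ((map (Algebra.lsmul K K M) (Algebra.lsmul K K N)).comp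
      (opAlgEquiv K K B D).symm.toAlgHom)).toRingHom

theorem op_tmul_smul_tmul (b : B) (d : D) (x : M) (y : N) :
    op (b ⊗ₜ[K] d) • (x ⊗ₜ[K] y) = (op b • x) ⊗ₜ[K] (op d • y) :=
  rfl

instance tensorRightModule_isScalarTower (F : Type*) [CommSemiring F] [Algebra K F] [Algebra F B]
    [IsScalarTower K F B] [Module F M] [IsScalarTower K F M] [IsScalarTower F Bᵐᵒᵖ M] :
    IsScalarTower F (B ⊗[K] D)ᵐᵒᵖ (M ⊗[K] N) where
  smul_assoc c r z := by
    obtain ⟨r, rfl⟩ := op_surjective r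
    induction r with
    | zero => simp only [op_zero, smul_zero, zero_smul]
    | add r₁ r₂ h₁ h₂ => simp only [op_add, smul_add, add_smul, h₁, h₂]
    | tmul b d =>
      induction z with
      | zero => simp only [smul_zero]
      | add z₁ z₂ h₁ h₂ => simp only [smul_add, h₁, h₂]
      | tmul x y =>
        rw [← op_smul, TensorProduct.smul_tmul', op_tmul_smul_tmul, op_tmul_smul_tmul,
          TensorProduct.smul_tmul', op_smul, smul_assoc]

end RightModule

section Generator

variable {K B D M N : Type*} [Ring B] [AddCommGroup M] [Module Bᵐᵒᵖ M]
  [Ring D] [AddCommGroup N] [Module Dᵐᵒᵖ N]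

theorem IsGeneratorRightModule.of_sum_eq_one {ι : Type*} [Fintype ι] (m : ι → M)
    (p : ι → M →ₗ[Bᵐᵒᵖ] B) (h : ∑ j, p j (m j) = 1) : IsGeneratorRightModule B M := by
  let e := Fintype.equivFin ι
  refine ⟨Fintype.card ι,
    LinearMap.pi fun j => LinearMap.toSpanSingleton Bᵐᵒᵖ M (m (e.symm j)) ∘ₗ
      (opLinearEquiv Bᵐᵒᵖ : B ≃ₗ[Bᵐᵒᵖ] Bᵐᵒᵖ).toLinearMap,
    ∑ j, p (e.symm j) ∘ₗ LinearMap.proj j, LinearMap.ext fun b => ?_⟩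
  calc _ = ∑ j, p (e.symm j) (op b • m (e.symm j)) := LinearMap.sum_apply _ _ _
    _ = ∑ j, p j (op b • m j) := e.symm.sum_comp fun j => p j (op b • m j)
    _ = (∑ j, p j (m j)) * b := by simp only [map_smul, op_smul_eq_mul, Finset.sum_mul]
    _ = b := by rw [h, one_mul]

theorem IsGeneratorRightModule.exists_sum_eq_one (h : IsGeneratorRightModule B M) :
    ∃ (n : ℕ) (m : Fin n → M) (p : Fin n → M →ₗ[Bᵐᵒᵖ] B), ∑ j, p j (m j) = 1 := by
  obtain ⟨n, i, p, hpi⟩ := h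
  refine ⟨n, i 1, fun j => p ∘ₗ LinearMap.single Bᵐᵒᵖ (fun _ => M) j, ?_⟩
  calc ∑ j, p (Pi.single j (i 1 j)) = p (∑ j, Pi.single j (i 1 j)) := (map_sum p _ _).symm
    _ = p (i 1) := by rw [Finset.univ_sum_single]
    _ = 1 := LinearMap.congr_fun hpi 1

variable (B) in
theorem isGeneratorRightModule_self : IsGeneratorRightModule B B :=
  .of_sum_eq_one (fun _ : Unit => 1) (fun _ => LinearMap.id) (Fintype.sum_unique _)

variable [CommRing K] [Algebra K B] [Module K M] [IsScalarTower K Bᵐᵒᵖ M] [Algebra K D]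
  [Module K N] [IsScalarTower K Dᵐᵒᵖ N]

theorem exists_rightLinearMap_tmul_eq (p : M →ₗ[Bᵐᵒᵖ] B) (q : N →ₗ[Dᵐᵒᵖ] D) :
    ∃ r : M ⊗[K] N →ₗ[(B ⊗[K] D)ᵐᵒᵖ] B ⊗[K] D, ∀ x y, r (x ⊗ₜ y) = p x ⊗ₜ q y := by
  let r : M ⊗[K] N →ₗ[K] B ⊗[K] D :=
    TensorProduct.map (p.restrictScalars K) (q.restrictScalars K)
  refine ⟨{ r with map_smul' := fun s z => ?_ }, fun _ _ => rfl⟩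
  obtain ⟨s, rfl⟩ := op_surjective s
  change r (op s • z) = r z * s
  induction s with
  | zero => simp only [op_zero, zero_smul, map_zero, mul_zero]
  | add s₁ s₂ h₁ h₂ => simp only [op_add, add_smul, map_add, mul_add, h₁, h₂]
  | tmul b d =>
    induction z with
    | zero => simp only [smul_zero, map_zero, zero_mul]
    | add z₁ z₂ h₁ h₂ => simp only [smul_add, map_add, add_mul, h₁, h₂]
    | tmul x y =>
      simp only [r, op_tmul_smul_tmul, TensorProduct.map_tmul, LinearMap.coe_restrictScalars,
        map_smul, op_smul_eq_mul, tmul_mul_tmul]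

variable (K) in
theorem IsGeneratorRightModule.tensorProduct (hM : IsGeneratorRightModule B M)
    (hN : IsGeneratorRightModule D N) : IsGeneratorRightModule (B ⊗[K] D) (M ⊗[K] N) := by
  obtain ⟨k, m, p, hp⟩ := hM.exists_sum_eq_one
  obtain ⟨l, n, q, hq⟩ := hN.exists_sum_eq_one
  choose r hr using fun j : Fin k × Fin l => exists_rightLinearMap_tmul_eq (K := K) (p j.1) (q j.2)
  refine .of_sum_eq_one (fun j => m j.1 ⊗ₜ n j.2) r ?_
  simp only [hr, Fintype.sum_prod_type, ← TensorProduct.tmul_sum, ← TensorProduct.sum_tmul, hp, hq,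
    one_def]

end Generator

section EndTensor

variable (K F M N : Type*) [Field K] [Field F] [Algebra K F]
  [AddCommGroup M] [Module K M] [Module F M] [IsScalarTower K F M] [AddCommGroup N] [Module K N]

section LeftModule

variable (R S : Type*) [Ring R] [Algebra K R] [Algebra F R] [Module R M] [IsScalarTower K R M]
  [IsScalarTower F R M] [Ring S] [Algebra K S] [Module S N] [IsScalarTower K S N]

theorem map_lsmul_end_injective :
    Function.Injective (map (Algebra.lsmul F F M : Module.End R M →ₐ[F] _)
      (Algebra.lsmul K K N : Module.End S N →ₐ[K] _)) :=
  TensorProduct.map_injective_of_flat_flat (Algebra.lsmul K F M).toLinearMap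
    (Algebra.lsmul K K N).toLinearMap (lsmul_end_injective K F R M) (lsmul_end_injective K K S N)

theorem range_map_lsmul_end [IsScalarTower K F R] :
    Set.range (map (Algebra.lsmul F F M : Module.End R M →ₐ[F] _)
        (Algebra.lsmul K K N : Module.End S N →ₐ[K] _)) =
      (Set.range (map (Algebra.lsmul F F M : R →ₐ[F] _)
        (Algebra.lsmul K K N : S →ₐ[K] _))).centralizer :=
  range_map_eq_centralizer (f := (Algebra.lsmul K F M : R →ₐ[K] _))
    (f' := (Algebra.lsmul K F M : Module.End R M →ₐ[K] _)) (range_lsmul_end K F R M)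
    (range_lsmul_end K K S N)

end LeftModule

variable (B D : Type*) [Ring B] [Algebra K B] [Algebra F B] [IsScalarTower K F B] [Module Bᵐᵒᵖ M]
  [IsScalarTower K Bᵐᵒᵖ M] [IsScalarTower F Bᵐᵒᵖ M] [Ring D] [Algebra K D] [Module Dᵐᵒᵖ N]
  [IsScalarTower K Dᵐᵒᵖ N]

theorem range_lsmul_tensorRightModule :
    Set.range (Algebra.lsmul F F (M ⊗[K] N) : (B ⊗[K] D)ᵐᵒᵖ →ₐ[F] _) =
      (Module.endTensorEndAlgHom : Module.End F M ⊗[K] Module.End K N →ₐ[F] _) ''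
        Set.range (map (Algebra.lsmul F F M : Bᵐᵒᵖ →ₐ[F] _)
          (Algebra.lsmul K K N : Dᵐᵒᵖ →ₐ[K] _)) := by
  have hfactor : (Algebra.lsmul F F (M ⊗[K] N)).comp (opAlgEquiv K F B D).toAlgHom =
      Module.endTensorEndAlgHom.comp (map (Algebra.lsmul F F M) (Algebra.lsmul K K N)) := by
    ext <;> rfl
  rw [← Set.range_comp, ← AlgHom.coe_comp, ← hfactor, AlgHom.coe_comp]
  exact ((opAlgEquiv K F B D).surjective.range_comp _).symm

theorem nonempty_endTensorEnd_algEquiv [Module.Finite F M] [Module.Finite K N] :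
    Nonempty (Module.End Bᵐᵒᵖ M ⊗[K] Module.End Dᵐᵒᵖ N ≃ₐ[F]
      Module.End (B ⊗[K] D)ᵐᵒᵖ (M ⊗[K] N)) := by
  let E : Module.End F M ⊗[K] Module.End K N →ₐ[F] Module.End F (M ⊗[K] N) :=
    Module.endTensorEndAlgHom
  have hE : Function.Bijective E := homTensorHomMap_bijective K F M N M N
  let α : Module.End Bᵐᵒᵖ M ⊗[K] Module.End Dᵐᵒᵖ N →ₐ[F] Module.End F M ⊗[K] Module.End K N :=
    map (Algebra.lsmul F F M) (Algebra.lsmul K K N)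
  have hα : Function.Injective α := map_lsmul_end_injective K F M N Bᵐᵒᵖ Dᵐᵒᵖ
  let β : Module.End (B ⊗[K] D)ᵐᵒᵖ (M ⊗[K] N) →ₐ[F] Module.End F (M ⊗[K] N) :=
    Algebra.lsmul F F (M ⊗[K] N)
  have hβ : Function.Injective β := lsmul_end_injective F F _ _
  have hrange : Set.range (E.comp α) = Set.range β := by
    rw [AlgHom.coe_comp, Set.range_comp, range_map_lsmul_end, image_centralizer hE,
      range_lsmul_end, range_lsmul_tensorRightModule]
  exact ⟨(AlgEquiv.ofInjective (E.comp α) (hE.injective.comp hα)).trans <|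
    (Subalgebra.equivOfEq _ _ (SetLike.coe_injective hrange)).trans
      (AlgEquiv.ofInjective β hβ).symm⟩

end EndTensor

section GendoSymmetric

theorem IsGendoSymmetric.of_algEquiv {K : Type*} [Field K] {A A' : Type u} [Ring A] [Algebra K A]
    [Ring A'] [Algebra K A'] (h : IsGendoSymmetric K A) (e : A ≃ₐ[K] A') :
    IsGendoSymmetric K A' := by
  obtain ⟨B, _, _, M, _, _, _, _, hB, hM, hgen, ⟨f⟩⟩ := h
  exact ⟨B, _, _, M, _, _, _, _, hB, hM, hgen, ⟨e.symm.trans f⟩⟩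

theorem IsSymmetricAlg.isGendoSymmetric {K B : Type*} [Field K] [Ring B] [Algebra K B]
    (h : IsSymmetricAlg K B) : IsGendoSymmetric K B :=
  ⟨B, _, _, B, _, _, _, inferInstance, h, h.1, isGeneratorRightModule_self B,
    ⟨AlgEquiv.moduleEndSelfOp K⟩⟩

theorem IsGendoSymmetric.tensorProduct {K F : Type*} [Field K] [Field F] [Algebra K F]
    {A : Type v} [Ring A] [Algebra K A] [Algebra F A] [IsScalarTower K F A]
    {C : Type w} [Ring C] [Algebra K C]
    (hA : IsGendoSymmetric F A) (hC : IsGendoSymmetric K C) :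
    IsGendoSymmetric F (A ⊗[K] C) := by
  obtain ⟨B, _, _, M, _, _, _, _, hB, _, hM, ⟨e⟩⟩ := hA
  obtain ⟨D, _, _, N, _, _, _, _, hD, _, hN, ⟨f⟩⟩ := hC
  let : Algebra K B := Algebra.compHom B (algebraMap K F)
  have : IsScalarTower K F B := .of_algebraMap_eq fun _ => rfl
  let : Module K M := Module.compHom M (algebraMap K F)
  have : IsScalarTower K F M := .of_algebraMap_smul fun _ _ => rfl
  have : IsScalarTower K Bᵐᵒᵖ M := .to₁₃₄ K F Bᵐᵒᵖ M
  obtain ⟨g⟩ := nonempty_endTensorEnd_algEquiv K F M N B D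
  exact ⟨B ⊗[K] D, inferInstance, inferInstance, M ⊗[K] N, inferInstance, inferInstance,
    inferInstance, inferInstance, hB.tensorProduct hD, finite_tensorProduct K F M N,
    hM.tensorProduct K hN, ⟨(congr e f).trans g⟩⟩

end GendoSymmetric

theorem mainTheorem3 (K : Type u) [Field K] :
    -- the tensor product of two gendo-symmetric `K`-algebras is a gendo-symmetric `K`-algebra
    (∀ (A : Type v) [Ring A] [Algebra K A] (B : Type w) [Ring B] [Algebra K B],
      IsGendoSymmetric K A → IsGendoSymmetric K B → IsGendoSymmetric K (A ⊗[K] B)) ∧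
    -- for every field extension `F` of `K`, `A ⊗[K] F` is a gendo-symmetric `F`-algebra, and,
    -- if `F` is finite over `K`, also a gendo-symmetric `K`-algebra
    (∀ (A : Type v) [Ring A] [Algebra K A] (F : Type x) [Field F] [Algebra K F],
      IsGendoSymmetric K A →
        @IsGendoSymmetric F _ (A ⊗[K] F) _ Algebra.TensorProduct.rightAlgebra ∧
        (Module.Finite K F → IsGendoSymmetric K (A ⊗[K] F))) := by
  refine ⟨fun A _ _ B _ _ hA hB => hA.tensorProduct hB, fun A _ _ F _ _ hA => ⟨?_, fun _ => ?_⟩⟩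
  · let : Algebra F (A ⊗[K] F) := Algebra.TensorProduct.rightAlgebra
    have hF : IsGendoSymmetric F F := (isSymmetricAlg_field F F).isGendoSymmetric
    exact (hF.tensorProduct hA).of_algEquiv (Algebra.TensorProduct.commRight K F A)
  · exact hA.tensorProduct (isSymmetricAlg_field K F).isGendoSymmetric
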